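/- Let $(\mathbb F_1,\mathbb F_2)$ be one of $(\mathbb R,\mathbb R)$, $(\mathbb C,\mathbb C)$, $(\mathbb C,\mathbb R)$, and let $G$ be a (discrete) group. A unital $\mathbb F_1$-operator space is an $\mathbb F_1$-linear subspace $X\subseteq B(H)$ with $1\in X$, where $H$ is a Hilbert space over $\mathbb F_1$; it is an $\mathbb F_1$-operator system if moreover $X=X^\star:=\{x^*:x\in X\}$. A unital $\mathbb F_1$-$G$-operator space (resp. $\mathbb F_1$-$G$-operator system) is a unital $\mathbb F_1$-operator space (resp. $\mathbb F_1$-operator system) on which $G$ acts by unital surjective $\mathbb F_1$-linear complete isometries (resp. unital $\mathbb F_1$-linear complete order isomorphisms). Let $\mathsf{OSp}^{\mathbb 1}_{(\mathbb F_1,\mathbb F_2)}$ be the category of unital $\mathbb F_1$-operator spaces and unital completely contractive $\mathbb F_2$-linear maps, $\mathsf{OSy}_{(\mathbb F_1,\mathbb F_2)}$ the category of $\mathbb F_1$-operator systems and unital completely positive $\mathbb F_2$-linear maps, and let $\mathsf{OSp}^{\mathbb 1,G}_{(\mathbb F_1,\mathbb F_2)}$, $\mathsf{OSy}^{G}_{(\mathbb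 F_1,\mathbb F_2)}$ be the corresponding categories of $G$-objects with $G$-equivariant morphisms. The Arveson functor $$\mathcal F_A:\mathsf{OSp}^{\mathbb 1}_{(\mathbb F_1,\mathbb F_2)}\to\mathsf{OSy}_{(\mathbb F_1,\mathbb F_2)},\qquad \mathcal F_A:\mathsf{OSp}^{\mathbb 1,G}_{(\mathbb F_1,\mathbb F_2)}\to\mathsf{OSy}^{G}_{(\mathbb F_1,\mathbb F_2)}$$ sends $X\subseteq B(H)$ to $X+X^\star\subseteq B(H)$ (with the action $g(x+y^*)=gx+(gy)^*$ in the $G$-case) and a morphism $u:X\to Y$ to $\tilde u:X+X^\star\to Y+Y^\star$, $\tilde u(x+y^*)=u(x)+u(y)^*$. In all six cases, $\mathcal F_A$ is faithful, not full, and essentially surjective. Non-fullness is witnessed as follows. Let $\mathcal T_2\subseteq M_2(\mathbb F_1)=B(\mathbb F_1^2)$ be the space of upper triangular matrices (with the trivial $G$-action in the $G$-case). Then $\mathcal T_2+\mathcal T_2^\star=M_2(\mathbb F_1)$; the flip $*$-automorphism $$\begin{bmatrix}a_{11}&a_{12}\\a_{21}&a_{22}\end{bmatrix}\mapsto\begin{bmatrix}0&1\\1&0\end{bmatrix}\begin{bmatrix}a_{11}&a_{12}\\a_{21}&a_{22}\end{bmatrix}\begin{bmatrix}0&1\\1&0\end{bmatrix}=\begin{bmatrix}a_{22}&a_{21}\\a_{12}&a_{11}\end{bmatrix}$$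 of $M_2(\mathbb F_1)$ does not map $\mathcal T_2$ into itself; and it is a morphism $\mathcal F_A(\mathcal T_2)\to\mathcal F_A(\mathcal T_2)$ which is not of the form $\mathcal F_A(f)$ for any morphism $f:\mathcal T_2\to\mathcal T_2$. -/

import Mathlib

open CategoryTheory

universe u v

noncomputable section

namespace OperatorCat

section Matrices

variable {𝕜 : Type} [RCLike 𝕜] {H : Type u} [NormedAddCommGroup H] [InnerProductSpace 𝕜 H]

/-- The canonical identification `M_n(B(H)) ≅ B(Hⁿ)`, where `Hⁿ` is the `ℓ²`-direct sum:
`(matrixOp a ξ)_i = ∑_j a_{ij} ξ_j`. -/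
def matrixOp {n : ℕ} (a : Matrix (Fin n) (Fin n) (H →L[𝕜] H)) :
    PiLp 2 (fun _ : Fin n => H) →L[𝕜] PiLp 2 (fun _ : Fin n => H) :=
  ((PiLp.continuousLinearEquiv 2 𝕜 (fun _ : Fin n => H)).symm : _ →L[𝕜] _) ∘L
    ContinuousLinearMap.pi (fun i => ∑ j, a i j ∘L PiLp.proj 2 (fun _ : Fin n => H) j)

theorem matrixOp_apply {n : ℕ} (a : Matrix (Fin n) (Fin n) (H →L[𝕜] H))
    (ξ : PiLp 2 (fun _ : Fin n => H)) (i : Fin n) :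
    matrixOp a ξ i = ∑ j, a i j (ξ j) := by
  simp [matrixOp]

theorem inner_matrixOp {n : ℕ} (a : Matrix (Fin n) (Fin n) (H →L[𝕜] H))
    (ξ η : PiLp 2 (fun _ : Fin n => H)) :
    inner 𝕜 (matrixOp a ξ) η = ∑ i, ∑ j, inner 𝕜 (a i j (ξ j)) (η i) := by
  simp [PiLp.inner_apply, matrixOp_apply, sum_inner]

theorem inner_matrixOp_single {n : ℕ} (a : Matrix (Fin n) (Fin n) (H →L[𝕜] H))
    (i j : Fin n) (v w : H) :
    inner 𝕜 (matrixOp a (WithLp.toLp 2 (Pi.single j v))) (WithLp.toLp 2 (Pi.single i w)) =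
      inner 𝕜 (a i j v) w := by
  rw [inner_matrixOp, Finset.sum_eq_single i, Finset.sum_eq_single j]
  · simp
  · intro k _ hk; simp [hk]
  · simp
  · intro k _ hk; simp [hk]
  · simp

theorem isSymmetric_matrixOp_iff [CompleteSpace H] {n : ℕ}
    (a : Matrix (Fin n) (Fin n) (H →L[𝕜] H)) :
    (matrixOp a).IsSymmetric ↔ ∀ i j, star (a i j) = a j i := by
  constructor
  · intro h i j
    rw [ContinuousLinearMap.star_eq_adjoint]
    refine ContinuousLinearMap.ext fun w => ext_inner_right 𝕜 fun v => ?_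
    have := h (WithLp.toLp 2 (Pi.single i w)) (WithLp.toLp 2 (Pi.single j v))
    simp only [ContinuousLinearMap.coe_coe] at this
    rw [inner_matrixOp_single] at this
    rw [ContinuousLinearMap.adjoint_inner_left, this, ← inner_conj_symm]
    exact (congrArg _ (inner_matrixOp_single a i j v w).symm).trans (inner_conj_symm _ _)
  · intro h ξ η
    simp only [ContinuousLinearMap.coe_coe]
    rw [← inner_conj_symm ξ, inner_matrixOp, inner_matrixOp, map_sum, Finset.sum_comm]
    refine Finset.sum_congr rfl fun i _ => ?_
    rw [map_sum]
    refine Finset.sum_congr rfl fun j _ => ?_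
    rw [inner_conj_symm, ← h i j, ContinuousLinearMap.star_eq_adjoint,
      ContinuousLinearMap.adjoint_inner_left]

theorem norm_natCast_sub_apply_sq {K : Type*} [NormedAddCommGroup K] [InnerProductSpace 𝕜 K]
    (T : K →L[𝕜] K) (m : ℕ) (ξ : K) :
    ‖((m : 𝕜) • (1 : K →L[𝕜] K) - T) ξ‖ ^ 2 =
      (m : ℝ) ^ 2 * ‖ξ‖ ^ 2 - 2 * m * RCLike.re (inner 𝕜 (T ξ) ξ) + ‖T ξ‖ ^ 2 := by
  have h : ((m : 𝕜) • (1 : K →L[𝕜] K) - T) ξ = (m : 𝕜) • ξ - T ξ := rfl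
  have h' : ∀ z : 𝕜, RCLike.re ((m : 𝕜) * z) = m * RCLike.re z := fun z => by
    rw [← RCLike.ofReal_natCast, RCLike.re_ofReal_mul]
  rw [h, @norm_sub_sq 𝕜, norm_smul, inner_smul_left, RCLike.norm_natCast, map_natCast,
    h', inner_re_symm]
  ring

theorem accretive_of_norm_le {E F : Type*} [NormedAddCommGroup E] [InnerProductSpace 𝕜 E]
    [NormedAddCommGroup F] [InnerProductSpace 𝕜 F] (A : E →L[𝕜] E) (B : F →L[𝕜] F)
    (h : ∀ m : ℕ, ‖(m : 𝕜) • (1 : F →L[𝕜] F) - B‖ ≤ ‖(m : 𝕜) • (1 : E →L[𝕜] E) - A‖)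
    (hA : ∀ ξ, 0 ≤ RCLike.re (inner 𝕜 (A ξ) ξ)) (η : F) :
    0 ≤ RCLike.re (inner 𝕜 (B η) η) := by
  have bound : ∀ m : ℕ, ‖(m : 𝕜) • (1 : E →L[𝕜] E) - A‖ ^ 2 ≤ (m : ℝ) ^ 2 + ‖A‖ ^ 2 := by
    intro m
    have h0 : (0 : ℝ) ≤ (m : ℝ) ^ 2 + ‖A‖ ^ 2 := by positivity
    have : ‖(m : 𝕜) • (1 : E →L[𝕜] E) - A‖ ≤ Real.sqrt ((m : ℝ) ^ 2 + ‖A‖ ^ 2) := by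
      refine ContinuousLinearMap.opNorm_le_bound _ (Real.sqrt_nonneg _) fun ξ => ?_
      refine abs_le_of_sq_le_sq' ?_ (by positivity) |>.2
      rw [norm_natCast_sub_apply_sq, mul_pow, Real.sq_sqrt h0]
      have h1 : ‖A ξ‖ ^ 2 ≤ (‖A‖ * ‖ξ‖) ^ 2 := by
        gcongr
        exact A.le_opNorm ξ
      have h2 : 0 ≤ 2 * (m : ℝ) * RCLike.re (inner 𝕜 (A ξ) ξ) :=
        mul_nonneg (by positivity) (hA ξ)
      nlinarith
    calc _ ≤ Real.sqrt ((m : ℝ) ^ 2 + ‖A‖ ^ 2) ^ 2 := by gcongr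
      _ = _ := Real.sq_sqrt h0
  by_contra! hneg
  obtain ⟨m, hm⟩ := exists_nat_gt (‖A‖ ^ 2 * ‖η‖ ^ 2 / (-2 * RCLike.re (inner 𝕜 (B η) η)))
  rw [div_lt_iff₀ (by linarith)] at hm
  have h1 : ‖((m : 𝕜) • (1 : F →L[𝕜] F) - B) η‖ ^ 2 ≤
      (‖(m : 𝕜) • (1 : F →L[𝕜] F) - B‖ * ‖η‖) ^ 2 := by
    gcongr
    exact ContinuousLinearMap.le_opNorm _ η
  have h2 : ‖(m : 𝕜) • (1 : F →L[𝕜] F) - B‖ ^ 2 ≤ (m : ℝ) ^ 2 + ‖A‖ ^ 2 :=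
    le_trans (by gcongr; exact h m) (bound m)
  rw [norm_natCast_sub_apply_sq, mul_pow] at h1
  have h3 := mul_le_mul_of_nonneg_right h2 (sq_nonneg ‖η‖)
  nlinarith [sq_nonneg ‖B η‖]

end Matrices

/-- An operator space over `𝕜`: a linear subspace of `B(H)` for a Hilbert space `H` over `𝕜`. -/
structure OperatorSpace (𝕜 : Type) [RCLike 𝕜] : Type (u + 1) where
  H : Type u
  [normed : NormedAddCommGroup H]
  [innerProduct : InnerProductSpace 𝕜 H]
  [complete : CompleteSpace H]
  space : Submodule 𝕜 (H →L[𝕜] H)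

attribute [instance] OperatorSpace.normed OperatorSpace.innerProduct OperatorSpace.complete

/-- A unital operator space: an operator space in `B(H)` which contains the identity operator. -/
structure UnitalOperatorSpace (𝕜 : Type) [RCLike 𝕜] : Type (u + 1)
    extends OperatorSpace.{u} 𝕜 where
  one_mem : (1 : H →L[𝕜] H) ∈ space

/-- An operator system: a unital operator space which is closed under adjoints. -/
structure OperatorSystem (𝕜 : Type) [RCLike 𝕜] : Type (u + 1)
    extends UnitalOperatorSpace.{u} 𝕜 where
  star_mem : ∀ x ∈ space, star x ∈ space

section Maps

variable {𝕜 : Type} [RCLike 𝕜]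

/-- The unit of a unital operator space, as an element of the space. -/
def UnitalOperatorSpace.unit (X : UnitalOperatorSpace.{u} 𝕜) : X.space := ⟨1, X.one_mem⟩

/-- The inclusion `M_n(X) ⊆ M_n(B(H)) = B(Hⁿ)`. -/
def OperatorSpace.amp (X : OperatorSpace.{u} 𝕜) {n : ℕ} (a : Matrix (Fin n) (Fin n) X.space) :
    PiLp 2 (fun _ : Fin n => X.H) →L[𝕜] PiLp 2 (fun _ : Fin n => X.H) :=
  matrixOp (a.map fun x => (x : X.H →L[𝕜] X.H))

/-- `‖f_n(a)‖ ≤ ‖a‖` for all `n` and all `a ∈ M_n(X)`, where `f_n` applies `f` entrywise. -/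
def IsCompletelyContractive {X Y : OperatorSpace.{u} 𝕜} (f : X.space → Y.space) : Prop :=
  ∀ (n : ℕ) (a : Matrix (Fin n) (Fin n) X.space), ‖Y.amp (a.map f)‖ ≤ ‖X.amp a‖

/-- `‖f_n(a)‖ = ‖a‖` for all `n` and all `a ∈ M_n(X)`. -/
def IsCompletelyIsometric {X Y : OperatorSpace.{u} 𝕜} (f : X.space → Y.space) : Prop :=
  ∀ (n : ℕ) (a : Matrix (Fin n) (Fin n) X.space), ‖Y.amp (a.map f)‖ = ‖X.amp a‖

/-- `f_n(a) ≥ 0` for all `n` and all `a ≥ 0` in `M_n(X)`. -/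
def IsCompletelyPositive {X Y : OperatorSpace.{u} 𝕜} (f : X.space → Y.space) : Prop :=
  ∀ (n : ℕ) (a : Matrix (Fin n) (Fin n) X.space),
    (X.amp a).IsPositive → (Y.amp (a.map f)).IsPositive

/-- `f_n(a) ≥ 0` if and only if `a ≥ 0`, for all `n` and all `a ∈ M_n(X)`. -/
def IsCompleteOrderEmbedding {X Y : OperatorSpace.{u} 𝕜} (f : X.space → Y.space) : Prop :=
  ∀ (n : ℕ) (a : Matrix (Fin n) (Fin n) X.space),
    (X.amp a).IsPositive ↔ (Y.amp (a.map f)).IsPositive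

end Maps

/-- A unital `G`-operator space: `G` acts by linear unital surjective complete isometries. -/
structure GUnitalOperatorSpace (𝕜 : Type) [RCLike 𝕜] (G : Type v) [Group G] :
    Type (max (u + 1) v) extends UnitalOperatorSpace.{u} 𝕜 where
  action : G →* (space ≃ₗ[𝕜] space)
  action_unit : ∀ g, action g toUnitalOperatorSpace.unit = toUnitalOperatorSpace.unit
  action_isometric : ∀ g,
    IsCompletelyIsometric (X := toOperatorSpace) (Y := toOperatorSpace) (action g)

/-- A `G`-operator system: `G` acts by linear unital complete order isomorphisms. -/
structure GOperatorSystem (𝕜 : Type) [RCLike 𝕜] (G : Type v) [Group G] :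
    Type (max (u + 1) v) extends OperatorSystem.{u} 𝕜 where
  action : G →* (space ≃ₗ[𝕜] space)
  action_unit : ∀ g, action g toUnitalOperatorSpace.unit = toUnitalOperatorSpace.unit
  action_order : ∀ g,
    IsCompleteOrderEmbedding (X := toOperatorSpace) (Y := toOperatorSpace) (action g)

section Morphisms

variable {𝕜₁ : Type} (𝕜₂ : Type) [RCLike 𝕜₁] [RCLike 𝕜₂] [Algebra 𝕜₂ 𝕜₁]

/-- Unital completely contractive `𝕜₂`-linear maps between unital `𝕜₁`-operator spaces. -/
@[ext]
structure UCCMap (X Y : UnitalOperatorSpace.{u} 𝕜₁) where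
  toFun : X.space →+ Y.space
  map_smul : ∀ (c : 𝕜₂) (x : X.space),
    toFun (algebraMap 𝕜₂ 𝕜₁ c • x) = algebraMap 𝕜₂ 𝕜₁ c • toFun x
  map_unit : toFun X.unit = Y.unit
  contractive : IsCompletelyContractive (X := X.toOperatorSpace) (Y := Y.toOperatorSpace) toFun

/-- Unital completely positive `𝕜₂`-linear maps between `𝕜₁`-operator systems. -/
@[ext]
structure UCPMap (X Y : OperatorSystem.{u} 𝕜₁) where
  toFun : X.space →+ Y.space
  map_smul : ∀ (c : 𝕜₂) (x : X.space),
    toFun (algebraMap 𝕜₂ 𝕜₁ c • x) = algebraMap 𝕜₂ 𝕜₁ c • toFun x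
  map_unit : toFun X.unit = Y.unit
  positive : IsCompletelyPositive (X := X.toOperatorSpace) (Y := Y.toOperatorSpace) toFun

/-- Equivariant unital completely contractive `𝕜₂`-linear maps. -/
@[ext]
structure GUCCMap {G : Type v} [Group G] (X Y : GUnitalOperatorSpace.{u} 𝕜₁ G) extends
    UCCMap 𝕜₂ X.toUnitalOperatorSpace Y.toUnitalOperatorSpace where
  equivariant : ∀ (g : G) (x : X.space), toFun (X.action g x) = Y.action g (toFun x)

/-- Equivariant unital completely positive `𝕜₂`-linear maps. -/
@[ext]
structure GUCPMap {G : Type v} [Group G] (X Y : GOperatorSystem.{u} 𝕜₁ G) extends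
    UCPMap 𝕜₂ X.toOperatorSystem Y.toOperatorSystem where
  equivariant : ∀ (g : G) (x : X.space), toFun (X.action g x) = Y.action g (toFun x)

variable {𝕜₂}

/-- The identity map. -/
def UCCMap.id (X : UnitalOperatorSpace.{u} 𝕜₁) : UCCMap 𝕜₂ X X where
  toFun := AddMonoidHom.id _
  map_smul _ _ := rfl
  map_unit := rfl
  contractive _ _ := le_rfl

/-- Composition (first `f`, then `g`). -/
def UCCMap.comp {X Y Z : UnitalOperatorSpace.{u} 𝕜₁} (f : UCCMap 𝕜₂ X Y) (g : UCCMap 𝕜₂ Y Z) :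
    UCCMap 𝕜₂ X Z where
  toFun := g.toFun.comp f.toFun
  map_smul c x := by simp [f.map_smul, g.map_smul]
  map_unit := by simp [f.map_unit, g.map_unit]
  contractive n a := (g.contractive n (a.map f.toFun)).trans (f.contractive n a)

/-- The identity map. -/
def UCPMap.id (X : OperatorSystem.{u} 𝕜₁) : UCPMap 𝕜₂ X X where
  toFun := AddMonoidHom.id _
  map_smul _ _ := rfl
  map_unit := rfl
  positive _ _ h := h

/-- Composition (first `f`, then `g`). -/
def UCPMap.comp {X Y Z : OperatorSystem.{u} 𝕜₁} (f : UCPMap 𝕜₂ X Y) (g : UCPMap 𝕜₂ Y Z) :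
    UCPMap 𝕜₂ X Z where
  toFun := g.toFun.comp f.toFun
  map_smul c x := by simp [f.map_smul, g.map_smul]
  map_unit := by simp [f.map_unit, g.map_unit]
  positive n a h := g.positive n (a.map f.toFun) (f.positive n a h)

/-- The identity map. -/
def GUCCMap.id {G : Type v} [Group G] (X : GUnitalOperatorSpace.{u} 𝕜₁ G) : GUCCMap 𝕜₂ X X where
  toUCCMap := UCCMap.id _
  equivariant _ _ := rfl

/-- Composition (first `f`, then `g`). -/
def GUCCMap.comp {G : Type v} [Group G] {X Y Z : GUnitalOperatorSpace.{u} 𝕜₁ G}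
    (f : GUCCMap 𝕜₂ X Y) (g : GUCCMap 𝕜₂ Y Z) : GUCCMap 𝕜₂ X Z where
  toUCCMap := f.toUCCMap.comp g.toUCCMap
  equivariant k x := (congrArg g.toFun (f.equivariant k x)).trans (g.equivariant k _)

/-- The identity map. -/
def GUCPMap.id {G : Type v} [Group G] (X : GOperatorSystem.{u} 𝕜₁ G) : GUCPMap 𝕜₂ X X where
  toUCPMap := UCPMap.id _
  equivariant _ _ := rfl

/-- Composition (first `f`, then `g`). -/
def GUCPMap.comp {G : Type v} [Group G] {X Y Z : GOperatorSystem.{u} 𝕜₁ G}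
    (f : GUCPMap 𝕜₂ X Y) (g : GUCPMap 𝕜₂ Y Z) : GUCPMap 𝕜₂ X Z where
  toUCPMap := f.toUCPMap.comp g.toUCPMap
  equivariant k x := (congrArg g.toFun (f.equivariant k x)).trans (g.equivariant k _)

end Morphisms

section Categories

/-- The objects of the category of unital `𝕜₁`-operator spaces and unital completely contractive
`𝕜₂`-linear maps (`𝕜₂` enters only through the morphisms). -/
@[nolint unusedArguments]
def OSpOne (𝕜₁ 𝕜₂ : Type) [RCLike 𝕜₁] [RCLike 𝕜₂] [Algebra 𝕜₂ 𝕜₁] : Type (u + 1) :=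
  UnitalOperatorSpace.{u} 𝕜₁

/-- The objects of the category of `𝕜₁`-operator systems and unital completely positive
`𝕜₂`-linear maps. -/
@[nolint unusedArguments]
def OSy (𝕜₁ 𝕜₂ : Type) [RCLike 𝕜₁] [RCLike 𝕜₂] [Algebra 𝕜₂ 𝕜₁] : Type (u + 1) :=
  OperatorSystem.{u} 𝕜₁

/-- The objects of the category of unital `𝕜₁`-`G`-operator spaces and `G`-equivariant unital
completely contractive `𝕜₂`-linear maps. -/
@[nolint unusedArguments]
def OSpOneG (𝕜₁ 𝕜₂ : Type) [RCLike 𝕜₁] [RCLike 𝕜₂] [Algebra 𝕜₂ 𝕜₁]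
    (G : Type v) [Group G] : Type (max (u + 1) v) :=
  GUnitalOperatorSpace.{u} 𝕜₁ G

/-- The objects of the category of `𝕜₁`-`G`-operator systems and `G`-equivariant unital completely
positive `𝕜₂`-linear maps. -/
@[nolint unusedArguments]
def OSyG (𝕜₁ 𝕜₂ : Type) [RCLike 𝕜₁] [RCLike 𝕜₂] [Algebra 𝕜₂ 𝕜₁]
    (G : Type v) [Group G] : Type (max (u + 1) v) :=
  GOperatorSystem.{u} 𝕜₁ G

variable (𝕜₁ 𝕜₂ : Type) [RCLike 𝕜₁] [RCLike 𝕜₂] [Algebra 𝕜₂ 𝕜₁] (G : Type v) [Group G]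

instance : Category (OSpOne.{u} 𝕜₁ 𝕜₂) where
  Hom X Y := UCCMap 𝕜₂ X Y
  id X := UCCMap.id X
  comp f g := UCCMap.comp f g

instance : Category (OSy.{u} 𝕜₁ 𝕜₂) where
  Hom X Y := UCPMap 𝕜₂ X Y
  id X := UCPMap.id X
  comp f g := UCPMap.comp f g

instance : Category (OSpOneG.{u} 𝕜₁ 𝕜₂ G) where
  Hom X Y := GUCCMap 𝕜₂ X Y
  id X := GUCCMap.id X
  comp f g := GUCCMap.comp f g

instance : Category (OSyG.{u} 𝕜₁ 𝕜₂ G) where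
  Hom X Y := GUCPMap 𝕜₂ X Y
  id X := GUCPMap.id X
  comp f g := GUCPMap.comp f g

end Categories

section Arveson

variable {𝕜 : Type} [RCLike 𝕜]

/-- The subspace `X + X⋆ = {x + y⋆ : x, y ∈ X}` of `B(H)`. -/
def UnitalOperatorSpace.addStar (X : UnitalOperatorSpace.{u} 𝕜) :
    Submodule 𝕜 (X.H →L[𝕜] X.H) where
  carrier := {z | ∃ x ∈ X.space, ∃ y ∈ X.space, z = x + star y}
  zero_mem' := ⟨0, X.space.zero_mem, 0, X.space.zero_mem, by simp⟩
  add_mem' := by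
    rintro _ _ ⟨x, hx, y, hy, rfl⟩ ⟨x', hx', y', hy', rfl⟩
    exact ⟨x + x', X.space.add_mem hx hx', y + y', X.space.add_mem hy hy', by
      rw [star_add]; abel⟩
  smul_mem' := by
    rintro c _ ⟨x, hx, y, hy, rfl⟩
    exact ⟨c • x, X.space.smul_mem c hx, star c • y, X.space.smul_mem _ hy, by
      rw [star_smul, star_star, smul_add]⟩

/-- The operator system `X + X⋆` generated by a unital operator space `X`. -/
def UnitalOperatorSpace.arveson (X : UnitalOperatorSpace.{u} 𝕜) : OperatorSystem.{u} 𝕜 where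
  H := X.H
  space := X.addStar
  one_mem := ⟨1, X.one_mem, 0, X.space.zero_mem, by simp⟩
  star_mem := by
    rintro _ ⟨x, hx, y, hy, rfl⟩
    exact ⟨y, hy, x, hx, by rw [star_add, star_star, add_comm]⟩

variable {X Y Z : UnitalOperatorSpace.{u} 𝕜}

/-- The element `x + y⋆` of `X + X⋆`. -/
def addStarMk (x y : X.space) : X.arveson.space :=
  ⟨(x : X.H →L[𝕜] X.H) + star (y : X.H →L[𝕜] X.H), x, x.2, y, y.2, rfl⟩

theorem exists_mk (z : X.arveson.space) : ∃ x y : X.space, z = addStarMk x y := by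
  obtain ⟨z, x, hx, y, hy, rfl⟩ := z
  exact ⟨⟨x, hx⟩, ⟨y, hy⟩, rfl⟩

theorem accretive_map (f : X.space →+ Y.space) (h1 : f X.unit = Y.unit)
    (hf : IsCompletelyContractive (X := X.toOperatorSpace) (Y := Y.toOperatorSpace) f)
    {n : ℕ} (a : Matrix (Fin n) (Fin n) X.space)
    (ha : ∀ ξ, 0 ≤ RCLike.re (inner 𝕜 (X.amp a ξ) ξ)) (η : PiLp 2 (fun _ : Fin n => Y.H)) :
    0 ≤ RCLike.re (inner 𝕜 (Y.amp (a.map f) η) η) := by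
  refine accretive_of_norm_le (X.amp a) (Y.amp (a.map f)) (fun m => ?_) ha η
  have aux : ∀ (W : UnitalOperatorSpace.{u} 𝕜) (b : Matrix (Fin n) (Fin n) W.space),
      (m : 𝕜) • 1 - W.amp b =
        W.amp (Matrix.of fun i j => (if i = j then m • W.unit else 0) - b i j) := by
    intro W b
    ext ξ i
    have h : ((m : 𝕜) • 1 - W.amp b) ξ i = (m : 𝕜) • ξ i - W.amp b ξ i := rfl
    rw [h, OperatorSpace.amp, OperatorSpace.amp, matrixOp_apply, matrixOp_apply]
    simp only [Matrix.map_apply, Matrix.of_apply, Submodule.coe_sub, sub_apply,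
      Finset.sum_sub_distrib]
    congr 1
    rw [Finset.sum_eq_single i]
    · simp [UnitalOperatorSpace.unit, Nat.cast_smul_eq_nsmul]
    · intro j _ hj
      simp [Ne.symm hj]
    · simp
  rw [aux, aux]
  convert hf n _ using 3
  ext i j : 2
  simp only [Matrix.of_apply, Matrix.map_apply, map_sub]
  congr 1
  split_ifs
  · rw [map_nsmul, h1]
  · rw [map_zero]

theorem map_add_star_eq_zero (f : X.space →+ Y.space) (h1 : f X.unit = Y.unit)
    (hf : IsCompletelyContractive (X := X.toOperatorSpace) (Y := Y.toOperatorSpace) f)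
    (x y : X.space) (h : (x : X.H →L[𝕜] X.H) + star (y : X.H →L[𝕜] X.H) = 0) :
    (f x : Y.H →L[𝕜] Y.H) + star (f y : Y.H →L[𝕜] Y.H) = 0 := by
  have form : ∀ (W : UnitalOperatorSpace.{u} 𝕜) (p q : W.space)
      (ξ : PiLp 2 (fun _ : Fin 2 => W.H)),
      RCLike.re (inner 𝕜 (W.amp !![0, p; q, 0] ξ) ξ) =
        RCLike.re (inner 𝕜 (((p : W.H →L[𝕜] W.H) + star (q : W.H →L[𝕜] W.H)) (ξ 1)) (ξ 0)) := by
    intro W p q ξ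
    rw [OperatorSpace.amp, inner_matrixOp]
    simp [Fin.sum_univ_two, inner_add_left, ContinuousLinearMap.star_eq_adjoint,
      ContinuousLinearMap.adjoint_inner_left]
    rw [inner_re_symm]
  have pos : ∀ p q : X.space, (p : X.H →L[𝕜] X.H) + star (q : X.H →L[𝕜] X.H) = 0 →
      ∀ v w : Y.H, 0 ≤
        RCLike.re (inner 𝕜 (((f p : Y.H →L[𝕜] Y.H) + star (f q : Y.H →L[𝕜] Y.H)) v) w) := by
    intro p q hpq v w
    have := accretive_map f h1 hf !![0, p; q, 0] (fun ξ => by rw [form, hpq]; simp)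
      (WithLp.toLp 2 ![w, v])
    have e : (!![0, p; q, 0] : Matrix _ _ X.space).map f = !![0, f p; f q, 0] := by
      ext i j : 2
      fin_cases i <;> fin_cases j <;> simp
    rw [e, form] at this
    simpa using this
  refine ContinuousLinearMap.ext fun v => ?_
  have h2 := pos x y h v (-(((f x : Y.H →L[𝕜] Y.H) + star (f y : Y.H →L[𝕜] Y.H)) v))
  rw [inner_neg_right, inner_self_eq_norm_sq_to_K, map_neg] at h2
  norm_cast at h2
  have h3 : ‖((f x : Y.H →L[𝕜] Y.H) + star (f y : Y.H →L[𝕜] Y.H)) v‖ ^ 2 = 0 :=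
    le_antisymm (by simpa using h2) (sq_nonneg _)
  simpa using h3

/-- The map `x + y⋆ ↦ f x + (f y)⋆`. -/
def arvesonFun (f : X.space → Y.space) (z : X.arveson.space) : Y.arveson.space :=
  addStarMk (f (exists_mk z).choose) (f (exists_mk z).choose_spec.choose)

theorem arvesonFun_mk (f : X.space →+ Y.space) (h1 : f X.unit = Y.unit)
    (hf : IsCompletelyContractive (X := X.toOperatorSpace) (Y := Y.toOperatorSpace) f)
    (x y : X.space) :
    arvesonFun f (addStarMk x y) = addStarMk (f x) (f y) := by
  have h := (exists_mk (addStarMk x y)).choose_spec.choose_spec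
  rw [arvesonFun]
  set x' := (exists_mk (addStarMk x y)).choose
  set y' := (exists_mk (addStarMk x y)).choose_spec.choose
  have h' : (x : X.H →L[𝕜] X.H) + star (y : X.H →L[𝕜] X.H) =
    (x' : X.H →L[𝕜] X.H) + star (y' : X.H →L[𝕜] X.H) := congrArg Subtype.val h
  have h0 := map_add_star_eq_zero f h1 hf (x' - x) (y' - y) (by
    rw [Submodule.coe_sub, Submodule.coe_sub, star_sub]
    rw [sub_add_sub_comm, ← h', sub_self])
  rw [map_sub, map_sub, Submodule.coe_sub, Submodule.coe_sub, star_sub, sub_add_sub_comm,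
    sub_eq_zero] at h0
  refine Subtype.ext ?_
  show (f x' : Y.H →L[𝕜] Y.H) + star (f y' : Y.H →L[𝕜] Y.H) =
    (f x : Y.H →L[𝕜] Y.H) + star (f y : Y.H →L[𝕜] Y.H)
  exact h0

/-- The additive map `x + y⋆ ↦ f x + (f y)⋆`, for `f` unital and completely contractive. -/
def arvesonHom (f : X.space →+ Y.space) (h1 : f X.unit = Y.unit)
    (hf : IsCompletelyContractive (X := X.toOperatorSpace) (Y := Y.toOperatorSpace) f) :
    X.arveson.space →+ Y.arveson.space where
  toFun := arvesonFun f
  map_zero' := by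
    have h : (0 : X.arveson.space) = addStarMk 0 0 :=
      Subtype.ext (by simp [addStarMk]; rfl)
    rw [h, arvesonFun_mk f h1 hf]
    exact Subtype.ext (by simp [addStarMk]; rfl)
  map_add' z w := by
    obtain ⟨x, y, rfl⟩ := exists_mk z
    obtain ⟨x', y', rfl⟩ := exists_mk w
    have h : ∀ (W : UnitalOperatorSpace.{u} 𝕜) (a b c d : W.space),
        addStarMk a b + addStarMk c d =
          addStarMk (a + c) (b + d) := fun W a b c d =>
      Subtype.ext (by simp [addStarMk]; abel)
    rw [h, arvesonFun_mk f h1 hf, arvesonFun_mk f h1 hf, arvesonFun_mk f h1 hf, h, map_add,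
      map_add]

theorem arvesonHom_mk (f : X.space →+ Y.space) (h1 : f X.unit = Y.unit)
    (hf : IsCompletelyContractive (X := X.toOperatorSpace) (Y := Y.toOperatorSpace) f)
    (x y : X.space) :
    arvesonHom f h1 hf (addStarMk x y) = addStarMk (f x) (f y) :=
  arvesonFun_mk f h1 hf x y

theorem arvesonHom_unit (f : X.space →+ Y.space) (h1 : f X.unit = Y.unit)
    (hf : IsCompletelyContractive (X := X.toOperatorSpace) (Y := Y.toOperatorSpace) f) :
    arvesonHom f h1 hf X.arveson.unit = Y.arveson.unit := by
  have h : ∀ W : UnitalOperatorSpace.{u} 𝕜,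
      W.arveson.unit = addStarMk W.unit 0 := fun W =>
    Subtype.ext (by simp [addStarMk, UnitalOperatorSpace.unit]; rfl)
  rw [h, arvesonHom_mk, h1, map_zero, ← h]

theorem arvesonHom_smul (f : X.space →+ Y.space) (h1 : f X.unit = Y.unit)
    (hf : IsCompletelyContractive (X := X.toOperatorSpace) (Y := Y.toOperatorSpace) f)
    (c : 𝕜) (hc : ∀ x, f (c • x) = c • f x) (hc' : ∀ x, f (star c • x) = star c • f x)
    (z : X.arveson.space) : arvesonHom f h1 hf (c • z) = c • arvesonHom f h1 hf z := by
  obtain ⟨x, y, rfl⟩ := exists_mk z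
  have h : ∀ (W : UnitalOperatorSpace.{u} 𝕜) (a b : W.space),
      c • addStarMk a b = addStarMk (c • a) (star c • b) :=
    fun W a b => Subtype.ext (by
      simp only [addStarMk, Submodule.coe_smul, star_smul, star_star]
      exact smul_add _ _ _)
  rw [h, arvesonHom_mk, arvesonHom_mk, h, hc, hc']

theorem arvesonHom_positive (f : X.space →+ Y.space) (h1 : f X.unit = Y.unit)
    (hf : IsCompletelyContractive (X := X.toOperatorSpace) (Y := Y.toOperatorSpace) f) :
    IsCompletelyPositive (X := X.arveson.toOperatorSpace) (Y := Y.arveson.toOperatorSpace)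
      (arvesonHom f h1 hf) := by
  intro n a ha
  choose x y hxy using fun i j => exists_mk (a i j)
  have form : ∀ (W : UnitalOperatorSpace.{u} 𝕜) (p q : Fin n → Fin n → W.space)
      (ξ : PiLp 2 (fun _ : Fin n => W.H)),
      RCLike.re (inner 𝕜 (matrixOp (Matrix.of fun i j =>
        (p i j : W.H →L[𝕜] W.H) + star (q i j : W.H →L[𝕜] W.H)) ξ) ξ) =
      RCLike.re (inner 𝕜 (W.amp (Matrix.of fun i j => p i j + q j i) ξ) ξ) := by
    intro W p q ξ
    rw [OperatorSpace.amp, inner_matrixOp, inner_matrixOp]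
    simp only [Matrix.of_apply, Matrix.map_apply, Submodule.coe_add, add_apply,
      inner_add_left, Finset.sum_add_distrib, map_add]
    congr 1
    rw [Finset.sum_comm, map_sum, map_sum]
    refine Finset.sum_congr rfl fun i _ => ?_
    rw [map_sum, map_sum]
    refine Finset.sum_congr rfl fun j _ => ?_
    rw [ContinuousLinearMap.star_eq_adjoint, ContinuousLinearMap.adjoint_inner_left, inner_re_symm]
  have eX : X.arveson.amp a = matrixOp (Matrix.of fun i j =>
      (x i j : X.H →L[𝕜] X.H) + star (y i j : X.H →L[𝕜] X.H)) := by
    refine congrArg matrixOp ?_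
    ext i j : 2
    rw [Matrix.map_apply, hxy]
    rfl
  have eY : Y.arveson.amp (a.map (arvesonHom f h1 hf)) = matrixOp (Matrix.of fun i j =>
      (f (x i j) : Y.H →L[𝕜] Y.H) + star (f (y i j) : Y.H →L[𝕜] Y.H)) := by
    refine congrArg matrixOp ?_
    ext i j : 2
    rw [Matrix.map_apply, Matrix.map_apply, hxy, arvesonHom_mk]
    rfl
  rw [eX] at ha
  rw [eY]
  refine ⟨?_, fun η => ?_⟩
  · have hs := (isSymmetric_matrixOp_iff _).1 ha.1
    refine (isSymmetric_matrixOp_iff _).2 fun i j => ?_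
    have hij := hs i j
    simp only [Matrix.of_apply, star_add, star_star] at hij ⊢
    have h0 := map_add_star_eq_zero f h1 hf (y i j - x j i) (x i j - y j i) (by
      rw [Submodule.coe_sub, Submodule.coe_sub, star_sub]
      rw [sub_add_sub_comm, add_comm (y i j : X.H →L[𝕜] X.H), hij, sub_self])
    rw [map_sub, map_sub, Submodule.coe_sub, Submodule.coe_sub, star_sub, sub_add_sub_comm,
      sub_eq_zero] at h0
    rw [← h0, add_comm]
  · refine (accretive_map f h1 hf (Matrix.of fun i j => x i j + y j i) (fun ξ => ?_) η).trans_eq ?_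
    · rw [← form]
      exact ha.2 ξ
    · refine Eq.trans ?_ (form Y (fun i j => f (x i j)) (fun i j => f (y i j)) η).symm
      congr 4
      ext i j : 2
      simp

end Arveson

section ArvesonFunctor

variable {𝕜₁ : Type} [RCLike 𝕜₁]

/-- The additive map underlying the action of `g` on a unital `G`-operator space. -/
def GUnitalOperatorSpace.actionHom {G : Type v} [Group G] (X : GUnitalOperatorSpace.{u} 𝕜₁ G)
    (g : G) : X.space →+ X.space :=
  (X.action g : X.space →ₗ[𝕜₁] X.space).toAddMonoidHom

theorem GUnitalOperatorSpace.actionHom_contractive {G : Type v} [Group G]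
    (X : GUnitalOperatorSpace.{u} 𝕜₁ G) (g : G) :
    IsCompletelyContractive (X := X.toOperatorSpace) (Y := X.toOperatorSpace) (X.actionHom g) :=
  fun n a => (X.action_isometric g n a).le

/-- The map `x + y⋆ ↦ g x + (g y)⋆` on `X + X⋆`. -/
def GUnitalOperatorSpace.arvesonActionHom {G : Type v} [Group G]
    (X : GUnitalOperatorSpace.{u} 𝕜₁ G) (g : G) :
    X.arveson.space →+ X.arveson.space :=
  arvesonHom (X.actionHom g) (X.action_unit g) (X.actionHom_contractive g)

theorem GUnitalOperatorSpace.arvesonActionHom_mk {G : Type v} [Group G]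
    (X : GUnitalOperatorSpace.{u} 𝕜₁ G) (g : G) (x y : X.space) :
    X.arvesonActionHom g (addStarMk x y) = addStarMk (X.action g x) (X.action g y) :=
  arvesonHom_mk _ _ _ x y

theorem GUnitalOperatorSpace.arvesonActionHom_one {G : Type v} [Group G]
    (X : GUnitalOperatorSpace.{u} 𝕜₁ G) (z : X.arveson.space) :
    X.arvesonActionHom 1 z = z := by
  obtain ⟨x, y, rfl⟩ := exists_mk z
  rw [arvesonActionHom_mk, map_one]
  rfl

theorem GUnitalOperatorSpace.arvesonActionHom_mul {G : Type v} [Group G]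
    (X : GUnitalOperatorSpace.{u} 𝕜₁ G) (g h : G) (z : X.arveson.space) :
    X.arvesonActionHom (g * h) z = X.arvesonActionHom g (X.arvesonActionHom h z) := by
  obtain ⟨x, y, rfl⟩ := exists_mk z
  rw [arvesonActionHom_mk, arvesonActionHom_mk, arvesonActionHom_mk, map_mul]
  rfl

/-- The `G`-operator system `X + X⋆`, with the action `g (x + y⋆) = g x + (g y)⋆`. -/
def GUnitalOperatorSpace.arvesonG {G : Type v} [Group G]
    (X : GUnitalOperatorSpace.{u} 𝕜₁ G) : GOperatorSystem.{u} 𝕜₁ G where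
  toOperatorSystem := X.arveson
  action :=
    { toFun := fun g =>
        { toFun := X.arvesonActionHom g
          map_add' := map_add _
          map_smul' := fun c z => arvesonHom_smul _ _ _ c
            (fun x => (X.action g).map_smul c x) (fun x => (X.action g).map_smul _ x) z
          invFun := X.arvesonActionHom g⁻¹
          left_inv := fun z => by
            rw [← X.arvesonActionHom_mul, inv_mul_cancel, X.arvesonActionHom_one]
          right_inv := fun z => by
            rw [← X.arvesonActionHom_mul, mul_inv_cancel, X.arvesonActionHom_one] }
      map_one' := LinearEquiv.ext X.arvesonActionHom_one
      map_mul' := fun g h => LinearEquiv.ext (X.arvesonActionHom_mul g h) }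
  action_unit g := arvesonHom_unit _ (X.action_unit g) (X.actionHom_contractive g)
  action_order g n a := by
    refine ⟨fun h => arvesonHom_positive _ (X.action_unit g) (X.actionHom_contractive g) n a h,
      fun h => ?_⟩
    have h' := arvesonHom_positive _ (X.action_unit g⁻¹) (X.actionHom_contractive g⁻¹) n _ h
    have e : (a.map (X.arvesonActionHom g)).map (X.arvesonActionHom g⁻¹) = a := by
      ext i j : 2
      rw [Matrix.map_apply, Matrix.map_apply, ← X.arvesonActionHom_mul, inv_mul_cancel,
        X.arvesonActionHom_one]
    exact e ▸ h'

variable (𝕜₂ : Type) [RCLike 𝕜₂] [Algebra 𝕜₂ 𝕜₁] [StarModule 𝕜₂ 𝕜₁]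

variable {𝕜₂} in
/-- The unital completely positive map `x + y⋆ ↦ f x + (f y)⋆` from `X + X⋆` to `Y + Y⋆`. -/
def UCCMap.arveson {X Y : UnitalOperatorSpace.{u} 𝕜₁} (f : UCCMap 𝕜₂ X Y) :
    UCPMap 𝕜₂ X.arveson Y.arveson where
  toFun := arvesonHom f.toFun f.map_unit f.contractive
  map_smul c z := arvesonHom_smul _ _ _ _ (f.map_smul c)
    (fun x => by rw [← algebraMap_star_comm]; exact f.map_smul _ x) z
  map_unit := arvesonHom_unit _ _ _
  positive := arvesonHom_positive _ _ _

variable {𝕜₂} in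
theorem UCCMap.arveson_mk {X Y : UnitalOperatorSpace.{u} 𝕜₁} (f : UCCMap 𝕜₂ X Y)
    (x y : X.space) : f.arveson.toFun (addStarMk x y) = addStarMk (f.toFun x) (f.toFun y) :=
  arvesonHom_mk _ f.map_unit f.contractive x y

theorem UCCMap.arveson_id (X : UnitalOperatorSpace.{u} 𝕜₁) :
    (UCCMap.id X : UCCMap 𝕜₂ X X).arveson = UCPMap.id X.arveson := by
  refine UCPMap.ext (AddMonoidHom.ext fun z => ?_)
  obtain ⟨x, y, rfl⟩ := exists_mk z
  exact UCCMap.arveson_mk _ x y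

variable {𝕜₂} in
theorem UCCMap.arveson_comp {X Y Z : UnitalOperatorSpace.{u} 𝕜₁} (f : UCCMap 𝕜₂ X Y)
    (g : UCCMap 𝕜₂ Y Z) : (f.comp g).arveson = f.arveson.comp g.arveson := by
  refine UCPMap.ext (AddMonoidHom.ext fun z => ?_)
  obtain ⟨x, y, rfl⟩ := exists_mk z
  refine (UCCMap.arveson_mk _ x y).trans ?_
  refine Eq.trans ?_ (congrArg g.arveson.toFun (UCCMap.arveson_mk f x y)).symm
  exact (UCCMap.arveson_mk g _ _).symm

variable {𝕜₂} in
/-- The equivariant version of `UCCMap.arveson`. -/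
def GUCCMap.arvesonG {G : Type v} [Group G] {X Y : GUnitalOperatorSpace.{u} 𝕜₁ G}
    (f : GUCCMap 𝕜₂ X Y) : GUCPMap 𝕜₂ X.arvesonG Y.arvesonG where
  toUCPMap := f.toUCCMap.arveson
  equivariant g z := by
    obtain ⟨x, y, rfl⟩ := exists_mk (X := X.toUnitalOperatorSpace) z
    refine (congrArg f.toUCCMap.arveson.toFun (X.arvesonActionHom_mk g x y)).trans ?_
    refine Eq.trans ?_ (congrArg (Y.arvesonActionHom g) (f.toUCCMap.arveson_mk x y)).symm
    rw [UCCMap.arveson_mk, f.equivariant, f.equivariant, Y.arvesonActionHom_mk]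

variable (𝕜₁)

/-- The Arveson functor `X ↦ X + X⋆`, `f ↦ (x + y⋆ ↦ f x + (f y)⋆)`, from unital
`𝕜₁`-operator spaces to `𝕜₁`-operator systems, with `𝕜₂`-linear morphisms. -/
def arvesonFunctor : OSpOne.{u} 𝕜₁ 𝕜₂ ⥤ OSy.{u} 𝕜₁ 𝕜₂ where
  obj X := UnitalOperatorSpace.arveson X
  map f := UCCMap.arveson f
  map_id X := UCCMap.arveson_id 𝕜₂ X
  map_comp f g := UCCMap.arveson_comp f g

/-- The Arveson functor between the `G`-equivariant categories; `X + X⋆` carries the action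
`g (x + y⋆) = g x + (g y)⋆`. -/
def arvesonFunctorG (G : Type v) [Group G] : OSpOneG.{u} 𝕜₁ 𝕜₂ G ⥤ OSyG.{u} 𝕜₁ 𝕜₂ G where
  obj X := GUnitalOperatorSpace.arvesonG X
  map f := GUCCMap.arvesonG f
  map_id X := GUCPMap.ext (congrArg UCPMap.toFun (UCCMap.arveson_id 𝕜₂ X.toUnitalOperatorSpace))
  map_comp f g := GUCPMap.ext
    (congrArg UCPMap.toFun (UCCMap.arveson_comp f.toUCCMap g.toUCCMap))

end ArvesonFunctor

section Triangular

variable (𝕜 : Type) [RCLike 𝕜]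

/-- The upper triangular matrices in `M_2(𝕜)`. -/
def upperTriangular : Submodule 𝕜 (Matrix (Fin 2) (Fin 2) 𝕜) where
  carrier := {A | A 1 0 = 0}
  zero_mem' := rfl
  add_mem' {A B} hA hB := by
    have hA' : A 1 0 = 0 := hA
    have hB' : B 1 0 = 0 := hB
    show A 1 0 + B 1 0 = 0
    rw [hA', hB', add_zero]
  smul_mem' c A hA := by
    have hA' : A 1 0 = 0 := hA
    show c • A 1 0 = 0
    rw [hA', smul_zero]

/-- The unital operator space `T_2` of upper triangular matrices, acting on `𝕜²`. -/
def triangular : UnitalOperatorSpace.{0} 𝕜 where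
  H := EuclideanSpace 𝕜 (Fin 2)
  space := (upperTriangular 𝕜).map
    (Matrix.toEuclideanCLM (n := Fin 2) (𝕜 := 𝕜)).toAlgEquiv.toLinearMap
  one_mem := ⟨1, Matrix.one_apply_ne (by decide),
    map_one (Matrix.toEuclideanCLM (n := Fin 2) (𝕜 := 𝕜))⟩

/-- A unital operator space with the trivial action of `G`. -/
def UnitalOperatorSpace.trivialAction {𝕜 : Type} [RCLike 𝕜] (X : UnitalOperatorSpace.{u} 𝕜)
    (G : Type v) [Group G] : GUnitalOperatorSpace.{u} 𝕜 G where
  toUnitalOperatorSpace := X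
  action := 1
  action_unit _ := rfl
  action_isometric _ _ _ := rfl

/-- The flip `A ↦ S A S` of `M_2(𝕜)`, where `S` is the permutation matrix that exchanges the two
basis vectors, as a `⋆`-automorphism. -/
def flipAut : Matrix (Fin 2) (Fin 2) 𝕜 ≃⋆ₐ[𝕜] Matrix (Fin 2) (Fin 2) 𝕜 :=
  Unitary.conjStarAlgAut 𝕜 _ ⟨!![0, 1; 1, 0], by
    rw [Unitary.mem_iff, Matrix.star_eq_conjTranspose]
    constructor <;>
    · ext i j
      fin_cases i <;> fin_cases j <;> simp [Matrix.mul_apply, Fin.sum_univ_two]⟩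

theorem flipAut_apply (A : Matrix (Fin 2) (Fin 2) 𝕜) :
    flipAut 𝕜 A = !![A 1 1, A 1 0; A 0 1, A 0 0] := by
  rw [flipAut, Unitary.conjStarAlgAut_apply]
  ext i j
  fin_cases i <;> fin_cases j <;>
    simp [Matrix.mul_apply, Fin.sum_univ_two, Matrix.star_eq_conjTranspose,
      Matrix.vecMul, dotProduct]

variable {𝕜} in
/-- The endomorphism `g` of the operator system `T_2 + T_2⋆` is the restriction of the flip,
under the identification `M_2(𝕜) = B(𝕜²)`. -/
def IsFlip {𝕜₂ : Type} [RCLike 𝕜₂] [Algebra 𝕜₂ 𝕜]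
    (g : UCPMap 𝕜₂ (triangular 𝕜).arveson (triangular 𝕜).arveson) : Prop :=
  ∀ (A : Matrix (Fin 2) (Fin 2) 𝕜)
    (hA : Matrix.toEuclideanCLM (n := Fin 2) (𝕜 := 𝕜) A ∈ (triangular 𝕜).addStar),
    (g.toFun ⟨Matrix.toEuclideanCLM (n := Fin 2) (𝕜 := 𝕜) A, hA⟩).1 =
      Matrix.toEuclideanCLM (n := Fin 2) (𝕜 := 𝕜) (flipAut 𝕜 A)

end Triangular

end OperatorCat

end

open OperatorCat

/-! Faithfulness holds because the extension `x + y⋆ ↦ f x + (f y)⋆` restricts to `f` on `X` (take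
`y = 0`).

Essential surjectivity holds because an operator system `S`, regarded only as a unital operator
space, satisfies `S + S⋆ = S`, and the identity map is then an isomorphism of systems. With a group
action there is more to check: `G` acts on `S` by complete order isomorphisms, while a unital
`G`-operator space requires complete isometries. The bridge is the 2×2 trick: for `c ≥ 0`, `‖a‖ ≤ c`
exactly when `[[c, a], [a⋆, c]] ≥ 0`. A unital completely positive map is therefore completely
contractive (`IsCompletelyPositive.contractive`) and preserves adjoints
(`IsCompletelyPositive.map_star`). Contractivity of `g` and of `g⁻¹` makes `g` isometric, and
adjoint preservation identifies the induced action on `S + S⋆` with the original one.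

Fullness fails because every morphism in the image of the functor maps `X` into itself, whereas a
morphism of `X + X⋆` need not. If a unitary `U` satisfies `U X U⋆ ⊆ X⋆`, conjugation by `U` is a
unital completely positive endomorphism of `X + X⋆` (`conjUCP`), and it lies outside the image as
soon as `U X U⋆ ⊄ X` (`conjUCP_toFun_ne_arveson`). For upper triangular matrices and the swap
matrix, conjugation exchanges upper and lower triangular matrices, so both conditions hold.

All arguments are uniform in the pair of scalar fields; the only link between them is an algebra
structure compatible with conjugation. -/

noncomputable section

namespace OperatorCat

/-! ### Faithfulness: a morphism is the restriction of its extension. -/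

section Faithful

variable {𝕜₁ 𝕜₂ : Type} [RCLike 𝕜₁] [RCLike 𝕜₂] [Algebra 𝕜₂ 𝕜₁] [StarModule 𝕜₂ 𝕜₁]

theorem UCCMap.coe_arveson_mk_zero {X Y : UnitalOperatorSpace.{u} 𝕜₁} (f : UCCMap 𝕜₂ X Y)
    (x : X.space) :
    ((f.arveson.toFun (addStarMk x 0)).1 : Y.H →L[𝕜₁] Y.H) = (f.toFun x).1 := by
  rw [UCCMap.arveson_mk, map_zero]
  exact (congrArg _ (star_zero _)).trans (add_zero _)

theorem UCCMap.arveson_toFun_injective {X Y : UnitalOperatorSpace.{u} 𝕜₁} {f g : UCCMap 𝕜₂ X Y}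
    (h : f.arveson.toFun = g.arveson.toFun) : f.toFun = g.toFun := by
  refine AddMonoidHom.ext fun x => Subtype.ext ?_
  rw [← f.coe_arveson_mk_zero, ← g.coe_arveson_mk_zero, h]

theorem arvesonFunctor_faithful : (arvesonFunctor.{u} 𝕜₁ 𝕜₂).Faithful where
  map_injective h := UCCMap.ext (UCCMap.arveson_toFun_injective (congrArg UCPMap.toFun h))

theorem arvesonFunctorG_faithful (G : Type v) [Group G] :
    (arvesonFunctorG.{u, v} 𝕜₁ 𝕜₂ G).Faithful where
  map_injective {X Y _ _} h := GUCCMap.ext (UCCMap.arveson_toFun_injective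
    (congrArg (fun k : GUCPMap 𝕜₂ X.arvesonG Y.arvesonG => k.toFun) h))

end Faithful

/-! ### Unital completely positive maps are completely contractive, by the 2×2 trick. -/

section CompletelyPositive

variable {𝕜 : Type} [RCLike 𝕜]

/-- The matrix `[[c, a], [a⋆, c]]` with entries in an operator system. -/
def OperatorSystem.offDiag (S : OperatorSystem.{u} 𝕜) {n : ℕ} (c : ℝ)
    (a : Matrix (Fin n) (Fin n) S.space) : Matrix (Fin (n + n)) (Fin (n + n)) S.space :=
  (Matrix.fromBlocks (Matrix.diagonal fun _ => (c : 𝕜) • S.unit) a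
    (Matrix.of fun i j => ⟨star (a j i).1, S.star_mem _ (a j i).2⟩)
    (Matrix.diagonal fun _ => (c : 𝕜) • S.unit)).submatrix finSumFinEquiv.symm finSumFinEquiv.symm

/-- The splitting `ξ = (η, ζ)` enters through hypotheses so that it can be used both ways: cutting a
given `ξ` into halves, and gluing chosen `η` and `ζ`. -/
theorem inner_matrixOp_blocks {H : Type u} [NormedAddCommGroup H] [InnerProductSpace 𝕜 H] {n : ℕ}
    (c : ℝ) (p q : Matrix (Fin n) (Fin n) (H →L[𝕜] H))
    (ξ : PiLp 2 (fun _ : Fin (n + n) => H)) (η ζ : PiLp 2 (fun _ : Fin n => H))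
    (hη : ∀ i, ξ (Fin.castAdd n i) = η i) (hζ : ∀ i, ξ (Fin.natAdd n i) = ζ i) :
    inner 𝕜 (matrixOp ((Matrix.fromBlocks (Matrix.diagonal fun _ => (c : 𝕜) • 1) p q
      (Matrix.diagonal fun _ => (c : 𝕜) • 1)).submatrix
        finSumFinEquiv.symm finSumFinEquiv.symm) ξ) ξ =
      c * inner 𝕜 η η + inner 𝕜 (matrixOp p ζ) η + inner 𝕜 (matrixOp q η) ζ +
        c * inner 𝕜 ζ ζ := by
  have diag : ∀ θ : PiLp 2 (fun _ : Fin n => H),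
      ∑ i, ∑ j, inner 𝕜 ((Matrix.diagonal (fun _ => (c : 𝕜) • (1 : H →L[𝕜] H)) i j) (θ j)) (θ i) =
        (c : 𝕜) * inner 𝕜 θ θ := by
    intro θ
    rw [PiLp.inner_apply, Finset.mul_sum]
    refine Finset.sum_congr rfl fun i _ => ?_
    rw [Finset.sum_eq_single i]
    · simp [inner_smul_left]
    · intro j _ hj
      simp [Matrix.diagonal_apply_ne' _ hj]
    · simp
  rw [inner_matrixOp, inner_matrixOp, inner_matrixOp, Fin.sum_univ_add]
  simp only [Fin.sum_univ_add, Matrix.submatrix_apply, finSumFinEquiv_symm_apply_castAdd,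
    finSumFinEquiv_symm_apply_natAdd, Matrix.fromBlocks_apply₁₁, Matrix.fromBlocks_apply₁₂,
    Matrix.fromBlocks_apply₂₁, Matrix.fromBlocks_apply₂₂, hη, hζ, Finset.sum_add_distrib, diag]
  ring

theorem inner_matrixOp_star {H : Type u} [NormedAddCommGroup H] [InnerProductSpace 𝕜 H]
    [CompleteSpace H] {n : ℕ} (a : Matrix (Fin n) (Fin n) (H →L[𝕜] H))
    (ξ η : PiLp 2 (fun _ : Fin n => H)) :
    inner 𝕜 (matrixOp (Matrix.of fun i j => star (a j i)) ξ) η = inner 𝕜 ξ (matrixOp a η) := by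
  rw [← inner_conj_symm ξ, inner_matrixOp, inner_matrixOp, map_sum, Finset.sum_comm]
  refine Finset.sum_congr rfl fun i _ => ?_
  rw [map_sum]
  refine Finset.sum_congr rfl fun j _ => ?_
  rw [inner_conj_symm, Matrix.of_apply, ContinuousLinearMap.star_eq_adjoint,
    ContinuousLinearMap.adjoint_inner_left]

theorem re_inner_matrixOp_blocks_star {H : Type u} [NormedAddCommGroup H]
    [InnerProductSpace 𝕜 H] [CompleteSpace H] {n : ℕ}
    (c : ℝ) (p : Matrix (Fin n) (Fin n) (H →L[𝕜] H))
    (ξ : PiLp 2 (fun _ : Fin (n + n) => H)) (η ζ : PiLp 2 (fun _ : Fin n => H))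
    (hη : ∀ i, ξ (Fin.castAdd n i) = η i) (hζ : ∀ i, ξ (Fin.natAdd n i) = ζ i) :
    RCLike.re (inner 𝕜 (matrixOp ((Matrix.fromBlocks (Matrix.diagonal fun _ => (c : 𝕜) • 1) p
      (Matrix.of fun i j => star (p j i)) (Matrix.diagonal fun _ => (c : 𝕜) • 1)).submatrix
        finSumFinEquiv.symm finSumFinEquiv.symm) ξ) ξ) =
      c * (‖η‖ ^ 2 + ‖ζ‖ ^ 2) + 2 * RCLike.re (inner 𝕜 (matrixOp p ζ) η) := by
  rw [inner_matrixOp_blocks c p _ ξ η ζ hη hζ, inner_matrixOp_star, map_add, map_add, map_add,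
    RCLike.re_ofReal_mul, RCLike.re_ofReal_mul, inner_self_eq_norm_sq, inner_self_eq_norm_sq,
    inner_re_symm η]
  ring

theorem OperatorSystem.amp_offDiag (S : OperatorSystem.{u} 𝕜) {n : ℕ} (c : ℝ)
    (a : Matrix (Fin n) (Fin n) S.space) :
    S.amp (S.offDiag c a) =
      matrixOp ((Matrix.fromBlocks (Matrix.diagonal fun _ => (c : 𝕜) • 1)
        (a.map fun x => (x : S.H →L[𝕜] S.H))
        (Matrix.of fun i j => star ((a.map fun x => (x : S.H →L[𝕜] S.H)) j i))
        (Matrix.diagonal fun _ => (c : 𝕜) • 1)).submatrix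
          finSumFinEquiv.symm finSumFinEquiv.symm) := by
  rw [OperatorSpace.amp, OperatorSystem.offDiag, ← Matrix.submatrix_map,
    Matrix.fromBlocks_map, Matrix.diagonal_map rfl]
  rfl

/-- One half of the 2×2 trick. By Cauchy–Schwarz the cross term `2 Re ⟨a ζ, η⟩` is at least
`-2c‖ζ‖‖η‖`, so the quadratic form dominates `c (‖η‖ - ‖ζ‖)²`. -/
theorem OperatorSystem.isPositive_amp_offDiag (S : OperatorSystem.{u} 𝕜) {n : ℕ} {c : ℝ}
    (a : Matrix (Fin n) (Fin n) S.space) (hc : ‖S.amp a‖ ≤ c) :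
    (S.amp (S.offDiag c a)).IsPositive := by
  rw [S.amp_offDiag]
  refine ⟨(isSymmetric_matrixOp_iff _).2 fun i j => ?_, fun ξ => ?_⟩
  · simp only [Matrix.submatrix_apply]
    generalize finSumFinEquiv.symm i = i'
    generalize finSumFinEquiv.symm j = j'
    rcases i' with i | i <;> rcases j' with j | j
    · by_cases h : i = j
      · subst h; simp
      · simp [h, Ne.symm h]
    · simp
    · simp
    · by_cases h : i = j
      · subst h; simp
      · simp [h, Ne.symm h]
  · set η : PiLp 2 (fun _ : Fin n => S.H) := WithLp.toLp 2 fun i => ξ (Fin.castAdd n i)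
    set ζ : PiLp 2 (fun _ : Fin n => S.H) := WithLp.toLp 2 fun i => ξ (Fin.natAdd n i)
    refine le_of_le_of_eq ?_ (re_inner_matrixOp_blocks_star c _ ξ η ζ
      (fun _ => rfl) (fun _ => rfl)).symm
    have h1 : |RCLike.re (inner 𝕜 (S.amp a ζ) η)| ≤ c * ‖ζ‖ * ‖η‖ :=
      ((RCLike.abs_re_le_norm _).trans (norm_inner_le_norm _ _)).trans
        (by gcongr; exact (S.amp a).le_of_opNorm_le hc ζ)
    have h2 := (abs_le.1 h1).1
    have hc0 : 0 ≤ c := (norm_nonneg _).trans hc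
    have h3 := mul_nonneg hc0 (sq_nonneg (‖η‖ - ‖ζ‖))
    change 0 ≤ c * (‖η‖ ^ 2 + ‖ζ‖ ^ 2) + 2 * RCLike.re (inner 𝕜 (S.amp a ζ) η)
    nlinarith

/-- The other half of the 2×2 trick: positivity is tested on the vectors `(-t • p ζ, ζ)` and the
real parameter `t` is then optimised. -/
theorem norm_matrixOp_le_of_isPositive {H : Type u} [NormedAddCommGroup H]
    [InnerProductSpace 𝕜 H] [CompleteSpace H] {n : ℕ} {c : ℝ} (hc : 0 ≤ c)
    (p : Matrix (Fin n) (Fin n) (H →L[𝕜] H))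
    (h : (matrixOp ((Matrix.fromBlocks (Matrix.diagonal fun _ => (c : 𝕜) • 1) p
      (Matrix.of fun i j => star (p j i)) (Matrix.diagonal fun _ => (c : 𝕜) • 1)).submatrix
        finSumFinEquiv.symm finSumFinEquiv.symm)).IsPositive) :
    ‖matrixOp p‖ ≤ c := by
  refine ContinuousLinearMap.opNorm_le_bound _ hc fun ζ => ?_
  have key : ∀ t : ℝ, 0 ≤ c * ((t * ‖matrixOp p ζ‖) ^ 2 + ‖ζ‖ ^ 2) -
      2 * t * ‖matrixOp p ζ‖ ^ 2 := by
    intro t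
    -- The sign makes the cross term equal to `-2t‖p ζ‖²`.
    set η : PiLp 2 (fun _ : Fin n => H) := ((-t : ℝ) : 𝕜) • matrixOp p ζ
    have h1 := h.2 (WithLp.toLp 2 (Fin.append (fun i => η i) (fun i => ζ i)))
    refine le_of_le_of_eq (le_of_le_of_eq h1 (re_inner_matrixOp_blocks_star c p _ η ζ
      (Fin.append_left _ _) (Fin.append_right _ _))) ?_
    rw [inner_smul_right, RCLike.re_ofReal_mul, inner_self_eq_norm_sq, norm_smul, RCLike.norm_ofReal,
      abs_neg, mul_pow, sq_abs]
    ring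
  refine abs_le_of_sq_le_sq' ?_ (by positivity) |>.2
  -- For `c = 0` the choice `t = 1` already forces `p ζ = 0`. For `c > 0` the optimal `t = c⁻¹`
  -- gives `‖p ζ‖² ≤ c²‖ζ‖²`.
  rcases hc.eq_or_lt with rfl | hc
  · have := key 1
    linarith
  · have := mul_nonneg hc.le (key c⁻¹)
    field_simp at this
    nlinarith

variable {S T : OperatorSystem.{u} 𝕜}

/-- `IsPositive` includes symmetry. The image of the positive matrix `[[c, x], [x⋆, c]]` is thus
symmetric, and its two off-diagonal entries are `f x` and `f (x⋆)`. This works over `ℝ` as well as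
over `ℂ`. -/
theorem IsCompletelyPositive.map_star (f : S.space →+ T.space)
    (hf : IsCompletelyPositive (X := S.toOperatorSpace) (Y := T.toOperatorSpace) f)
    (x : S.space) :
    ((f ⟨star x.1, S.star_mem _ x.2⟩).1 : T.H →L[𝕜] T.H) = star (f x).1 := by
  -- The constant only has to bound the norm of the 1×1 matrix `x`; its value plays no further role.
  have h := hf _ _ (S.isPositive_amp_offDiag (c := ‖S.amp (Matrix.of fun _ _ : Fin 1 => x)‖)
    (Matrix.of fun _ _ : Fin 1 => x) le_rfl)
  have h' := (isSymmetric_matrixOp_iff _).1 h.1 (Fin.castAdd 1 0) (Fin.natAdd 1 0)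
  simp only [OperatorSystem.offDiag, Matrix.map_apply, Matrix.submatrix_apply,
    finSumFinEquiv_symm_apply_castAdd, finSumFinEquiv_symm_apply_natAdd,
    Matrix.fromBlocks_apply₁₂, Matrix.fromBlocks_apply₂₁, Matrix.of_apply] at h'
  exact h'.symm

/-- Real homogeneity suffices, since the only scalar occurring is the norm on the diagonal of the
2×2 block matrix. -/
theorem IsCompletelyPositive.contractive (f : S.space →+ T.space)
    (hsmul : ∀ (c : ℝ) (x : S.space), f ((c : 𝕜) • x) = (c : 𝕜) • f x)
    (h1 : f S.unit = T.unit)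
    (hf : IsCompletelyPositive (X := S.toOperatorSpace) (Y := T.toOperatorSpace) f) :
    IsCompletelyContractive (X := S.toOperatorSpace) (Y := T.toOperatorSpace) f := by
  intro n a
  have h := hf _ _ (S.isPositive_amp_offDiag a le_rfl)
  -- Unitality fixes the diagonal blocks and adjoint preservation handles the lower left one, so the
  -- image is the block matrix of `f_n(a)` with the same constant `‖a‖`.
  have e : (S.offDiag ‖S.amp a‖ a).map f = T.offDiag ‖S.amp a‖ (a.map f) := by
    rw [OperatorSystem.offDiag, OperatorSystem.offDiag, ← Matrix.submatrix_map,
      Matrix.fromBlocks_map, Matrix.diagonal_map (map_zero f)]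
    congr 2
    · ext i j : 2
      simp [hsmul, h1, Matrix.diagonal_apply]
    · ext i j : 2
      exact IsCompletelyPositive.map_star f hf (a j i)
    · ext i j : 2
      simp [hsmul, h1, Matrix.diagonal_apply]
  rw [e, T.amp_offDiag] at h
  exact norm_matrixOp_le_of_isPositive (norm_nonneg _) _ h

end CompletelyPositive

/-! ### Essential surjectivity: `S + S⋆ = S`, together with the group actions. -/

section EssSurj

variable {𝕜₁ : Type} [RCLike 𝕜₁]

/-- The two inclusions of subspaces provide the mutually inverse morphisms between `S + S⋆` and `S`,
with no transport along an equality of structures. -/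
theorem OperatorSystem.addStar_eq (S : OperatorSystem.{u} 𝕜₁) :
    S.toUnitalOperatorSpace.addStar = S.space := by
  refine le_antisymm ?_ fun x hx => ⟨x, hx, 0, S.space.zero_mem, by simp⟩
  rintro _ ⟨x, hx, y, hy, rfl⟩
  exact S.space.add_mem hx (S.star_mem y hy)

section

variable (𝕜₂ : Type) [RCLike 𝕜₂] [Algebra 𝕜₂ 𝕜₁]

/-- The identity map from `S + S⋆` to the operator system `S`. -/
def OperatorSystem.ofArveson (S : OperatorSystem.{u} 𝕜₁) :
    UCPMap 𝕜₂ S.toUnitalOperatorSpace.arveson S where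
  toFun := (Submodule.inclusion S.addStar_eq.le).toAddMonoidHom
  map_smul _ _ := rfl
  map_unit := rfl
  positive _ _ h := h

/-- The identity map from the operator system `S` to `S + S⋆`. -/
def OperatorSystem.toArveson (S : OperatorSystem.{u} 𝕜₁) :
    UCPMap 𝕜₂ S S.toUnitalOperatorSpace.arveson where
  toFun := (Submodule.inclusion S.addStar_eq.ge).toAddMonoidHom
  map_smul _ _ := rfl
  map_unit := rfl
  positive _ _ h := h

end

variable {G : Type v} [Group G]

theorem GOperatorSystem.action_contractive (S : GOperatorSystem.{u} 𝕜₁ G) (g : G) :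
    IsCompletelyContractive (X := S.toOperatorSpace) (Y := S.toOperatorSpace) (S.action g) :=
  IsCompletelyPositive.contractive (S := S.toOperatorSystem) (T := S.toOperatorSystem)
    (S.action g : S.space →ₗ[𝕜₁] S.space).toAddMonoidHom
    (fun c x => (S.action g).map_smul (c : 𝕜₁) x) (S.action_unit g)
    (fun n a h => (S.action_order g n a).1 h)

theorem GOperatorSystem.action_inv_apply (S : GOperatorSystem.{u} 𝕜₁ G) (g : G) (x : S.space) :
    S.action g⁻¹ (S.action g x) = x := by
  rw [← LinearEquiv.mul_apply, ← map_mul, inv_mul_cancel, map_one]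
  rfl

theorem GOperatorSystem.action_star (S : GOperatorSystem.{u} 𝕜₁ G) (g : G) (x : S.space) :
    ((S.action g ⟨star x.1, S.star_mem _ x.2⟩).1 : S.H →L[𝕜₁] S.H) = star (S.action g x).1 :=
  IsCompletelyPositive.map_star (S := S.toOperatorSystem) (T := S.toOperatorSystem)
    (S.action g : S.space →ₗ[𝕜₁] S.space).toAddMonoidHom
    (fun n a h => (S.action_order g n a).1 h) x

/-- A `G`-operator system, as a unital `G`-operator space. -/
def GOperatorSystem.toGUnitalOperatorSpace (S : GOperatorSystem.{u} 𝕜₁ G) :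
    GUnitalOperatorSpace.{u} 𝕜₁ G where
  toUnitalOperatorSpace := S.toUnitalOperatorSpace
  action := S.action
  action_unit := S.action_unit
  action_isometric g n a := by
    refine le_antisymm (S.action_contractive g n a) ?_
    -- The reverse inequality is contractivity of `g⁻¹` at the matrix `g a`.
    have h := S.action_contractive g⁻¹ n (a.map (S.action g))
    have e : (a.map (S.action g)).map (S.action g⁻¹) = a := by
      ext i j : 2
      exact congrArg Subtype.val (S.action_inv_apply g (a i j))
    rwa [e] at h

/-- This gives the equivariance of the identity map: `g x + (g y)⋆ = g (x + y⋆)`, because the action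
commutes with adjoints. -/
theorem GOperatorSystem.coe_arvesonG_action (S : GOperatorSystem.{u} 𝕜₁ G) (g : G)
    (z : S.toGUnitalOperatorSpace.arvesonG.space) (hz : z.1 ∈ S.space) :
    ((S.toGUnitalOperatorSpace.arvesonG.action g z).1 : S.H →L[𝕜₁] S.H) =
      (S.action g ⟨z.1, hz⟩).1 := by
  obtain ⟨x, y, rfl⟩ := exists_mk (X := S.toUnitalOperatorSpace) z
  refine (congrArg Subtype.val (S.toGUnitalOperatorSpace.arvesonActionHom_mk g x y)).trans ?_
  refine (congrArg ((S.action g x).1 + ·) (S.action_star g y).symm).trans ?_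
  exact (congrArg Subtype.val
    (map_add (S.action g) x ⟨star y.1, S.star_mem _ y.2⟩)).symm

variable {𝕜₂ : Type} [RCLike 𝕜₂] [Algebra 𝕜₂ 𝕜₁] [StarModule 𝕜₂ 𝕜₁]

theorem arvesonFunctor_essSurj : (arvesonFunctor.{u} 𝕜₁ 𝕜₂).EssSurj where
  mem_essImage S := ⟨OperatorSystem.toUnitalOperatorSpace S,
    ⟨{ hom := OperatorSystem.ofArveson 𝕜₂ S
       inv := OperatorSystem.toArveson 𝕜₂ S
       hom_inv_id := rfl
       inv_hom_id := rfl }⟩⟩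

variable (G) in
theorem arvesonFunctorG_essSurj : (arvesonFunctorG.{u, v} 𝕜₁ 𝕜₂ G).EssSurj where
  mem_essImage S := ⟨GOperatorSystem.toGUnitalOperatorSpace S,
    ⟨{ hom :=
        { toUCPMap := OperatorSystem.ofArveson 𝕜₂ (GOperatorSystem.toOperatorSystem S)
          equivariant := fun g z => Subtype.ext
            (GOperatorSystem.coe_arvesonG_action S g z
              ((GOperatorSystem.toOperatorSystem S).addStar_eq.le z.2)) }
       inv :=
        { toUCPMap := OperatorSystem.toArveson 𝕜₂ (GOperatorSystem.toOperatorSystem S)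
          equivariant := fun g z => Subtype.ext
            (GOperatorSystem.coe_arvesonG_action S g
              ((OperatorSystem.toArveson 𝕜₂ (GOperatorSystem.toOperatorSystem S)).toFun z) z.2).symm }
       hom_inv_id := rfl
       inv_hom_id := rfl }⟩⟩

end EssSurj

/-! ### Conjugations carrying `X` into `X⋆`, and why they lie outside the image of the functor. -/

section Conjugation

variable {𝕜 : Type} [RCLike 𝕜] {X : UnitalOperatorSpace.{u} 𝕜}

theorem isPositive_matrixOp_conj {H : Type u} [NormedAddCommGroup H] [InnerProductSpace 𝕜 H]
    [CompleteSpace H] (U : H →L[𝕜] H) {n : ℕ} {a : Matrix (Fin n) (Fin n) (H →L[𝕜] H)}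
    (ha : (matrixOp a).IsPositive) : (matrixOp (a.map fun x => U * x * star U)).IsPositive := by
  refine ⟨(isSymmetric_matrixOp_iff _).2 fun i j => ?_, fun ξ => ?_⟩
  · simp only [Matrix.map_apply, star_mul, star_star, (isSymmetric_matrixOp_iff _).1 ha.1 i j,
      mul_assoc]
  -- The form of the conjugated matrix at `ξ` is the form of `a` at the vector with entries `U⋆
  -- ξ_i`; unitarity is not involved.
  · refine (ha.2 (WithLp.toLp 2 fun i => star U (ξ i))).trans_eq ?_
    simp only [ContinuousLinearMap.reApplyInnerSelf_apply, inner_matrixOp, Matrix.map_apply,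
      mul_apply_eq_comp]
    simp only [ContinuousLinearMap.star_eq_adjoint, ContinuousLinearMap.adjoint_inner_right]

theorem conj_mem_addStar {U : X.H →L[𝕜] X.H}
    (hX : ∀ x ∈ X.space, star (U * x * star U) ∈ X.space) {z : X.H →L[𝕜] X.H} (hz : z ∈ X.addStar) :
    U * z * star U ∈ X.addStar := by
  obtain ⟨x, hx, y, hy, rfl⟩ := hz
  -- The summands exchange roles: `U y⋆ U⋆ = (U y U⋆)⋆` lies in `X`, and `U x U⋆` is the adjoint of
  -- an element of `X`.
  refine ⟨_, hX y hy, _, hX x hx, ?_⟩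
  simp only [star_mul, star_star, mul_add, add_mul, mul_assoc]
  exact add_comm _ _

variable {U : X.H →L[𝕜] X.H} (hX : ∀ x ∈ X.space, star (U * x * star U) ∈ X.space)

/-- The additive map `z ↦ U z U⋆` on `X + X⋆`, where `U X U⋆ ⊆ X⋆`. -/
def conjHom : X.addStar →+ X.addStar where
  toFun z := ⟨U * z.1 * star U, conj_mem_addStar hX z.2⟩
  map_zero' := Subtype.ext (by simp)
  map_add' z w := Subtype.ext (by simp [mul_add, add_mul])

variable (𝕜₂ : Type) [RCLike 𝕜₂] [Algebra 𝕜₂ 𝕜]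

/-- Conjugation by a unitary `U` such that `U X U⋆ ⊆ X⋆`, as an endomorphism of `X + X⋆`. -/
def conjUCP (hU : U * star U = 1) : UCPMap 𝕜₂ X.arveson X.arveson where
  toFun := conjHom hX
  map_smul c z := Subtype.ext <|
    (congrArg (· * star U) (mul_smul_comm (algebraMap 𝕜₂ 𝕜 c) U z.1)).trans
      (smul_mul_assoc _ _ _)
  map_unit := Subtype.ext ((congrArg (· * star U) (mul_one U)).trans hU)
  positive _ _ h := isPositive_matrixOp_conj U h

variable {𝕜₂} [StarModule 𝕜₂ 𝕜]

/-- The extension of `f` sends `x ∈ X` to `f x ∈ X`, while conjugation moves some element of `X` out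
of `X`. The comparison concerns underlying additive maps, so it serves the equivariant case too. -/
theorem conjUCP_toFun_ne_arveson (hU : U * star U = 1)
    (hne : ∃ x ∈ X.space, U * x * star U ∉ X.space) (f : UCCMap 𝕜₂ X X) :
    f.arveson.toFun ≠ (conjUCP hX 𝕜₂ hU).toFun := by
  obtain ⟨x, hx, hn⟩ := hne
  intro h
  have h1 := f.coe_arveson_mk_zero ⟨x, hx⟩
  rw [h] at h1
  have h2 : U * (x + star 0) * star U = (f.toFun ⟨x, hx⟩).1 := h1
  rw [star_zero, add_zero] at h2
  exact hn (h2 ▸ (f.toFun ⟨x, hx⟩).2)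

theorem trivialAction_arvesonG_action (G : Type v) [Group G] (g : G) (z : X.arveson.space) :
    (X.trivialAction G).arvesonG.action g z = z := by
  obtain ⟨x, y, rfl⟩ := exists_mk z
  exact (X.trivialAction G).arvesonActionHom_mk g x y

/-- The equivariant version of `conjUCP`, for the trivial action. -/
def conjGUCP (hU : U * star U = 1) (G : Type v) [Group G] :
    GUCPMap 𝕜₂ (X.trivialAction G).arvesonG (X.trivialAction G).arvesonG where
  toUCPMap := conjUCP hX 𝕜₂ hU
  equivariant g z :=
    (congrArg (conjUCP hX 𝕜₂ hU).toFun (trivialAction_arvesonG_action G g z)).trans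
      (trivialAction_arvesonG_action G g _).symm

theorem conjUCP_notMem_range (hU : U * star U = 1)
    (hne : ∃ x ∈ X.space, U * x * star U ∉ X.space) :
    conjUCP hX 𝕜₂ hU ∉ Set.range (fun f : UCCMap 𝕜₂ X X => f.arveson) := by
  rintro ⟨f, h⟩
  exact conjUCP_toFun_ne_arveson hX hU hne f (congrArg UCPMap.toFun h)

theorem conjGUCP_notMem_range (hU : U * star U = 1)
    (hne : ∃ x ∈ X.space, U * x * star U ∉ X.space) (G : Type v) [Group G] :
    conjGUCP hX hU G ∉ Set.range
      (fun f : GUCCMap 𝕜₂ (X.trivialAction G) (X.trivialAction G) => f.arvesonG) := by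
  rintro ⟨f, h⟩
  exact conjUCP_toFun_ne_arveson hX hU hne f.toUCCMap
    (congrArg (fun k : GUCPMap 𝕜₂ _ _ => k.toFun) h)

end Conjugation

/-! ### Upper triangular matrices and the flip. -/

section Triangular

variable {𝕜 : Type} [RCLike 𝕜] {H : Type u} [NormedAddCommGroup H] [InnerProductSpace 𝕜 H]
  [CompleteSpace H] (Φ : Matrix (Fin 2) (Fin 2) 𝕜 ≃⋆ₐ[𝕜] (H →L[𝕜] H))

/-- The upper triangular matrices, acting on `H` through an identification `M_2(𝕜) = B(H)`. -/
def triangularOn : UnitalOperatorSpace.{u} 𝕜 where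
  H := H
  space := (upperTriangular 𝕜).map Φ.toAlgEquiv.toLinearMap
  one_mem := ⟨1, Matrix.one_apply_ne (by decide), map_one Φ⟩

variable (𝕜) in
/-- The permutation matrix that exchanges the two basis vectors. -/
def swapMatrix : Matrix (Fin 2) (Fin 2) 𝕜 := !![0, 1; 1, 0]

theorem swapMatrix_mul_star : swapMatrix 𝕜 * star (swapMatrix 𝕜) = 1 := by
  ext i j
  fin_cases i <;> fin_cases j <;>
    simp [swapMatrix, Matrix.mul_apply, Fin.sum_univ_two, Matrix.star_eq_conjTranspose]

theorem swapMatrix_conj (A : Matrix (Fin 2) (Fin 2) 𝕜) :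
    swapMatrix 𝕜 * A * star (swapMatrix 𝕜) = flipAut 𝕜 A := by
  rw [flipAut, Unitary.conjStarAlgAut_apply]
  rfl

theorem map_swapMatrix_mul_star : Φ (swapMatrix 𝕜) * star (Φ (swapMatrix 𝕜)) = 1 := by
  rw [← map_star, ← map_mul, swapMatrix_mul_star, map_one]

theorem map_swapMatrix_conj (A : Matrix (Fin 2) (Fin 2) 𝕜) :
    Φ (swapMatrix 𝕜) * Φ A * star (Φ (swapMatrix 𝕜)) = Φ (flipAut 𝕜 A) := by
  rw [← map_star, ← map_mul, ← map_mul, swapMatrix_conj]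

/-- The flip turns upper triangular matrices into lower triangular ones, and the adjoint turns them
back. -/
theorem star_conj_mem_triangularOn (x : H →L[𝕜] H) (hx : x ∈ (triangularOn Φ).space) :
    star (Φ (swapMatrix 𝕜) * x * star (Φ (swapMatrix 𝕜))) ∈ (triangularOn Φ).space := by
  obtain ⟨A, hA, rfl⟩ := hx
  refine ⟨star (flipAut 𝕜 A), ?_, ?_⟩
  · have hA' : A 1 0 = 0 := hA
    show star (flipAut 𝕜 A) 1 0 = 0
    rw [flipAut_apply]
    simp [hA']
  · exact (map_star Φ _).trans (congrArg star (map_swapMatrix_conj Φ A).symm)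

variable (𝕜) in
theorem exists_flipAut_notMem : ∃ A ∈ upperTriangular 𝕜, flipAut 𝕜 A ∉ upperTriangular 𝕜 := by
  -- The flip sends the matrix unit `E₁₂` to `E₂₁`.
  refine ⟨!![0, 1; 0, 0], rfl, fun h => ?_⟩
  have h' : flipAut 𝕜 !![0, 1; 0, 0] 1 0 = 0 := h
  rw [flipAut_apply] at h'
  simp at h'

theorem exists_conj_notMem_triangularOn : ∃ x : H →L[𝕜] H, x ∈ (triangularOn Φ).space ∧
    Φ (swapMatrix 𝕜) * x * star (Φ (swapMatrix 𝕜)) ∉ (triangularOn Φ).space := by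
  obtain ⟨A, hA, hA'⟩ := exists_flipAut_notMem 𝕜
  refine ⟨Φ A, ⟨A, hA, rfl⟩, ?_⟩
  rw [map_swapMatrix_conj]
  rintro ⟨B, hB, h⟩
  exact hA' (Φ.injective h ▸ hB)

variable (𝕜) in
theorem triangular_addStar : (triangular 𝕜).addStar = ⊤ := by
  refine eq_top_iff.2 fun z _ => ?_
  obtain ⟨A, rfl⟩ := (Matrix.toEuclideanCLM (n := Fin 2) (𝕜 := 𝕜)).surjective z
  -- The upper triangular part of `A` is the first summand; the remaining lower left entry is the
  -- adjoint of a strictly upper triangular matrix.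
  refine ⟨_, ⟨!![A 0 0, A 0 1; 0, A 1 1], rfl, rfl⟩, _, ⟨!![0, star (A 1 0); 0, 0], rfl, rfl⟩, ?_⟩
  have h : A = !![A 0 0, A 0 1; 0, A 1 1] + star !![0, star (A 1 0); 0, 0] := by
    ext i j
    fin_cases i <;> fin_cases j <;> simp [Matrix.star_eq_conjTranspose]
  let Φ := Matrix.toEuclideanCLM (n := Fin 2) (𝕜 := 𝕜)
  exact (congrArg Φ h).trans ((map_add Φ _ _).trans (congrArg _ (map_star Φ _)))

variable (𝕜) in
/-- The identification of `M_2(𝕜)` with the operators on a two-dimensional Hilbert space in an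
arbitrary universe. -/
def matrixEquivULift : Matrix (Fin 2) (Fin 2) 𝕜 ≃⋆ₐ[𝕜]
    (EuclideanSpace 𝕜 (ULift.{u} (Fin 2)) →L[𝕜] EuclideanSpace 𝕜 (ULift.{u} (Fin 2))) :=
  (StarAlgEquiv.ofAlgEquiv (Matrix.reindexAlgEquiv 𝕜 𝕜 Equiv.ulift.{u}.symm)
    (fun _ => rfl)).trans Matrix.toEuclideanCLM

variable {𝕜₂ : Type} [RCLike 𝕜₂] [Algebra 𝕜₂ 𝕜] [StarModule 𝕜₂ 𝕜]

theorem arvesonFunctor_not_full : ¬ (arvesonFunctor.{u} 𝕜 𝕜₂).Full := by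
  intro h
  -- Failure of fullness is asserted in every universe, so the counterexample acts on a copy of `𝕜²`
  -- living in `Type u`.
  let Φ := matrixEquivULift.{u} 𝕜
  exact conjUCP_notMem_range (𝕜₂ := 𝕜₂) (star_conj_mem_triangularOn Φ) (map_swapMatrix_mul_star Φ)
    (exists_conj_notMem_triangularOn Φ)
    (h.map_surjective (X := triangularOn Φ) (Y := triangularOn Φ) _)

theorem arvesonFunctorG_not_full (G : Type v) [Group G] :
    ¬ (arvesonFunctorG.{u, v} 𝕜 𝕜₂ G).Full := by
  intro h
  let Φ := matrixEquivULift.{u} 𝕜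
  exact conjGUCP_notMem_range (𝕜₂ := 𝕜₂) (star_conj_mem_triangularOn Φ)
    (map_swapMatrix_mul_star Φ) (exists_conj_notMem_triangularOn Φ) G
    (h.map_surjective (X := (triangularOn Φ).trivialAction G)
      (Y := (triangularOn Φ).trivialAction G) _)

theorem exists_isFlip_notMem_range :
    ∃ g : (arvesonFunctor.{0} 𝕜 𝕜₂).obj (triangular 𝕜) ⟶
        (arvesonFunctor.{0} 𝕜 𝕜₂).obj (triangular 𝕜),
      IsFlip (𝕜₂ := 𝕜₂) g ∧ g ∉ Set.range (arvesonFunctor.{0} 𝕜 𝕜₂).map := by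
  -- For this `Φ`, `triangularOn Φ` unfolds to `triangular 𝕜`, so the general lemmas apply to the
  -- concrete space.
  let Φ := Matrix.toEuclideanCLM (n := Fin 2) (𝕜 := 𝕜)
  exact ⟨conjUCP (X := triangular 𝕜) (star_conj_mem_triangularOn Φ) 𝕜₂ (map_swapMatrix_mul_star Φ),
    fun A _ => map_swapMatrix_conj Φ A,
    conjUCP_notMem_range (X := triangular 𝕜) (star_conj_mem_triangularOn Φ)
      (map_swapMatrix_mul_star Φ) (exists_conj_notMem_triangularOn Φ)⟩

theorem exists_isFlip_notMem_rangeG (G : Type v) [Group G] :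
    ∃ g : (arvesonFunctorG.{0, v} 𝕜 𝕜₂ G).obj ((triangular 𝕜).trivialAction G) ⟶
        (arvesonFunctorG.{0, v} 𝕜 𝕜₂ G).obj ((triangular 𝕜).trivialAction G),
      IsFlip (GUCPMap.toUCPMap (𝕜₂ := 𝕜₂) g) ∧
        g ∉ Set.range (arvesonFunctorG.{0, v} 𝕜 𝕜₂ G).map := by
  let Φ := Matrix.toEuclideanCLM (n := Fin 2) (𝕜 := 𝕜)
  exact ⟨conjGUCP (X := triangular 𝕜) (star_conj_mem_triangularOn Φ) (map_swapMatrix_mul_star Φ) G,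
    fun A _ => map_swapMatrix_conj Φ A,
    conjGUCP_notMem_range (X := triangular 𝕜) (star_conj_mem_triangularOn Φ)
      (map_swapMatrix_mul_star Φ) (exists_conj_notMem_triangularOn Φ) G⟩

end Triangular

end OperatorCat

end



theorem mainTheorem10 (G : Type v) [Group G] :
    ( -- faithful in all six cases
      (arvesonFunctor.{u} ℝ ℝ).Faithful ∧
      (arvesonFunctor.{u} ℂ ℂ).Faithful ∧
      (arvesonFunctor.{u} ℂ ℝ).Faithful ∧
      (arvesonFunctorG.{u, v} ℝ ℝ G).Faithful ∧
      (arvesonFunctorG.{u, v} ℂ ℂ G).Faithful ∧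
      (arvesonFunctorG.{u, v} ℂ ℝ G).Faithful) ∧
    ( -- not full in all six cases
      ¬ (arvesonFunctor.{u} ℝ ℝ).Full ∧
      ¬ (arvesonFunctor.{u} ℂ ℂ).Full ∧
      ¬ (arvesonFunctor.{u} ℂ ℝ).Full ∧
      ¬ (arvesonFunctorG.{u, v} ℝ ℝ G).Full ∧
      ¬ (arvesonFunctorG.{u, v} ℂ ℂ G).Full ∧
      ¬ (arvesonFunctorG.{u, v} ℂ ℝ G).Full) ∧
    ( -- essentially surjective in all six cases
      (arvesonFunctor.{u} ℝ ℝ).EssSurj ∧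
      (arvesonFunctor.{u} ℂ ℂ).EssSurj ∧
      (arvesonFunctor.{u} ℂ ℝ).EssSurj ∧
      (arvesonFunctorG.{u, v} ℝ ℝ G).EssSurj ∧
      (arvesonFunctorG.{u, v} ℂ ℂ G).EssSurj ∧
      (arvesonFunctorG.{u, v} ℂ ℝ G).EssSurj) ∧
    ( -- `M_2 = T_2 + T_2⋆`, and the flip does not map `T_2` into itself
      (triangular ℝ).addStar = ⊤ ∧
      (triangular ℂ).addStar = ⊤ ∧
      (∃ A ∈ upperTriangular ℝ, flipAut ℝ A ∉ upperTriangular ℝ) ∧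
      (∃ A ∈ upperTriangular ℂ, flipAut ℂ A ∉ upperTriangular ℂ)) ∧
    ( -- the flip is a morphism of `T_2 + T_2⋆` outside the image of the functor, in all six cases
      (∃ g : (arvesonFunctor.{0} ℝ ℝ).obj (triangular ℝ) ⟶
          (arvesonFunctor.{0} ℝ ℝ).obj (triangular ℝ),
        IsFlip (𝕜₂ := ℝ) g ∧
          g ∉ Set.range (arvesonFunctor.{0} ℝ ℝ).map) ∧
      (∃ g : (arvesonFunctor.{0} ℂ ℂ).obj (triangular ℂ) ⟶
          (arvesonFunctor.{0} ℂ ℂ).obj (triangular ℂ),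
        IsFlip (𝕜₂ := ℂ) g ∧
          g ∉ Set.range (arvesonFunctor.{0} ℂ ℂ).map) ∧
      (∃ g : (arvesonFunctor.{0} ℂ ℝ).obj (triangular ℂ) ⟶
          (arvesonFunctor.{0} ℂ ℝ).obj (triangular ℂ),
        IsFlip (𝕜₂ := ℝ) g ∧
          g ∉ Set.range (arvesonFunctor.{0} ℂ ℝ).map) ∧
      (∃ g : (arvesonFunctorG.{0, v} ℝ ℝ G).obj ((triangular ℝ).trivialAction G) ⟶
          (arvesonFunctorG.{0, v} ℝ ℝ G).obj ((triangular ℝ).trivialAction G),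
        IsFlip (GUCPMap.toUCPMap (𝕜₂ := ℝ) g) ∧
          g ∉ Set.range (arvesonFunctorG.{0, v} ℝ ℝ G).map) ∧
      (∃ g : (arvesonFunctorG.{0, v} ℂ ℂ G).obj ((triangular ℂ).trivialAction G) ⟶
          (arvesonFunctorG.{0, v} ℂ ℂ G).obj ((triangular ℂ).trivialAction G),
        IsFlip (GUCPMap.toUCPMap (𝕜₂ := ℂ) g) ∧
          g ∉ Set.range (arvesonFunctorG.{0, v} ℂ ℂ G).map) ∧
      (∃ g : (arvesonFunctorG.{0, v} ℂ ℝ G).obj ((triangular ℂ).trivialAction G) ⟶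
          (arvesonFunctorG.{0, v} ℂ ℝ G).obj ((triangular ℂ).trivialAction G),
        IsFlip (GUCPMap.toUCPMap (𝕜₂ := ℝ) g) ∧
          g ∉ Set.range (arvesonFunctorG.{0, v} ℂ ℝ G).map)) := by
  exact
    ⟨⟨arvesonFunctor_faithful, arvesonFunctor_faithful, arvesonFunctor_faithful,
        arvesonFunctorG_faithful G, arvesonFunctorG_faithful G, arvesonFunctorG_faithful G⟩,
      ⟨arvesonFunctor_not_full, arvesonFunctor_not_full, arvesonFunctor_not_full,
        arvesonFunctorG_not_full G, arvesonFunctorG_not_full G, arvesonFunctorG_not_full G⟩,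
      ⟨arvesonFunctor_essSurj, arvesonFunctor_essSurj, arvesonFunctor_essSurj,
        arvesonFunctorG_essSurj G, arvesonFunctorG_essSurj G, arvesonFunctorG_essSurj G⟩,
      ⟨triangular_addStar ℝ, triangular_addStar ℂ, exists_flipAut_notMem ℝ,
        exists_flipAut_notMem ℂ⟩,
      ⟨exists_isFlip_notMem_range, exists_isFlip_notMem_range, exists_isFlip_notMem_range,
        exists_isFlip_notMem_rangeG G, exists_isFlip_notMem_rangeG G,
        exists_isFlip_notMem_rangeG G⟩⟩
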